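/- Let $G$ be a finite simple graph with at least one vertex that is outerplanar, i.e. $G$ has a drawing in the plane without crossings (vertices are distinct points, edges are simple arcs between their ends, meeting vertices and each other only at common ends) in which every vertex lies on the boundary of the outer (unbounded) face. Then $G$ has property $M(3)$: $G$ is not uniquely $3$-list colorable, that is, there is no assignment of a list $S_v$ of exactly three colors to each vertex $v$ of $G$ for which there is exactly one proper list coloring (a choice of a color $c(v)\in S_v$ for every vertex $v$ such that $c(u)\neq c(v)$ whenever $u$ and $v$ are adjacent). -/

import Mathlib

universe u w

/-! Uniquely list colorable graphs. -/

/-- `c` is a proper list coloring of `G` from the lists `L`: every vertex gets a color of its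
list, and adjacent vertices get different colors. -/
def IsProperListColoring {V : Type u} {C : Type w} (G : SimpleGraph V)
    (L : V → Finset C) (c : V → C) : Prop :=
  (∀ v, c v ∈ L v) ∧ ∀ u v, G.Adj u v → c u ≠ c v

/-- `G` is uniquely `k`-list colorable: for some assignment of lists of exactly `k` colors to the
vertices there is exactly one proper list coloring. -/
def IsUniquelyListColorable {V : Type u} (G : SimpleGraph V) (k : ℕ) : Prop :=
  ∃ (C : Type w) (L : V → Finset C), (∀ v, (L v).card = k) ∧ ∃! c : V → C,
    IsProperListColoring G L c

/-- Property `M(k)`: not uniquely `k`-list colorable. The universe `w` is the one in which the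
sets of colors live. -/
def PropertyM {V : Type u} (G : SimpleGraph V) (k : ℕ) : Prop :=
  ¬ IsUniquelyListColorable.{u, w} G k

/-! Drawings in the plane and outerplanar graphs. -/

/-- The Euclidean plane. -/
abbrev Plane : Type := EuclideanSpace ℝ (Fin 2)

/-- `A` is a (simple) arc with end points `p` and `q`: the image of an injective continuous path
from `p` to `q`. -/
def IsArcBetween (A : Set Plane) (p q : Plane) : Prop :=
  ∃ γ : Path p q, Function.Injective γ ∧ Set.range γ = A

/-- A drawing of `G` in the plane without crossings: distinct vertices are distinct points, every
edge is an arc joining its two ends, an edge contains no vertex apart from its ends, and two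
different edges have no common point other than a vertex. -/
structure PlaneDrawing {V : Type u} (G : SimpleGraph V) where
  /-- the point that represents a vertex -/
  vertex : V → Plane
  /-- the arc that represents an edge -/
  edge : G.edgeSet → Set Plane
  vertex_injective : Function.Injective vertex
  isArc : ∀ (u v : V) (h : G.Adj u v),
    IsArcBetween (edge ⟨s(u, v), (SimpleGraph.mem_edgeSet G).mpr h⟩) (vertex u) (vertex v)
  mem_of_vertex_mem : ∀ (e : G.edgeSet) (v : V), vertex v ∈ edge e → v ∈ (e : Sym2 V)
  edge_inter_edge : ∀ e f : G.edgeSet, e ≠ f → edge e ∩ edge f ⊆ Set.range vertex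

/-- The set of all points of the plane that are covered by the drawing. -/
def PlaneDrawing.carrier {V : Type u} {G : SimpleGraph V} (D : PlaneDrawing G) : Set Plane :=
  Set.range D.vertex ∪ ⋃ e, D.edge e

/-- The faces of a drawing are the connected components of the complement of the drawing. -/
def PlaneDrawing.IsFace {V : Type u} {G : SimpleGraph V} (D : PlaneDrawing G)
    (F : Set Plane) : Prop :=
  ∃ x ∈ D.carrierᶜ, F = connectedComponentIn D.carrierᶜ x

/-- The outer face is the unbounded face. -/
def PlaneDrawing.IsOuterFace {V : Type u} {G : SimpleGraph V} (D : PlaneDrawing G)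
    (F : Set Plane) : Prop :=
  D.IsFace F ∧ ¬ Bornology.IsBounded F

/-- `G` is outerplanar: it has a drawing in the plane without crossings in which every vertex lies
on the boundary of the outer face. -/
def IsOuterplanar {V : Type u} (G : SimpleGraph V) : Prop :=
  ∃ D : PlaneDrawing G, ∃ F : Set Plane, D.IsOuterFace F ∧ ∀ v, D.vertex v ∈ frontier F

/-! Every nonempty set S of vertices of an outerplanar graph has a member with at most two
neighbours in S (`exists_neighbors_subset_pair`). Lists of three colors then leave a free color at
that vertex, so two colorings of the rest of S both extend (`exists_two_colorings`).

If instead every vertex of S had three neighbours in S, a longest path in S would carry crossing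
chords (`exists_crossing_chords`), giving four vertices joined by six paths, opposite ones disjoint.
Joining them to a point of the outer face draws K5 with no two disjoint edges meeting.

`not_planar_five_complex` excludes this by parity. For two disjoint edges the difference of their
points never vanishes, so its argument has zero total variation around the parameter square. Modulo
2, the resulting integer equations for the 15 pairs of disjoint edges add up to a contradiction. -/

/-! ### Continuous logarithms along curves. -/

theorem exists_continuous_log {f : ℝ × ℝ → ℂ} (hf : Continuous f) (h0 : ∀ x, f x ≠ 0) :
    ∃ L : ℝ × ℝ → ℂ, Continuous L ∧ ∀ x, Complex.exp (L x) = f x := by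
  obtain ⟨L, ⟨-, hL⟩, -⟩ := Complex.isCoveringMapOn_exp.existsUnique_continuousMap_lifts
    (⟨f, hf⟩ : C(ℝ × ℝ, ℂ)) (a₀ := 0) (Complex.exp_log (h0 0)) h0
  exact ⟨L, L.continuous, fun x => congrFun hL x⟩

theorem exists_continuous_log_real {f : ℝ → ℂ} (hf : Continuous f) (h0 : ∀ x, f x ≠ 0) :
    ∃ L : ℝ → ℂ, Continuous L ∧ ∀ x, Complex.exp (L x) = f x := by
  obtain ⟨L, hL, h⟩ := exists_continuous_log (hf.comp continuous_fst) (fun x => h0 x.1)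
  exact ⟨fun t => L (t, 0), by fun_prop, fun x => h (x, 0)⟩

/-- The increment of a continuous logarithm does not depend on the logarithm. -/
theorem log_increment_unique {g h : ℝ → ℂ} (hg : Continuous g) (hh : Continuous h)
    (e : ∀ x, Complex.exp (g x) = Complex.exp (h x)) (a b : ℝ) : g b - g a = h b - h a := by
  have key := Complex.isCoveringMapOn_exp.existsUnique_continuousMap_lifts
    (⟨fun x => Complex.exp (g x), by fun_prop⟩ : C(ℝ, ℂ)) (a₀ := a) (e₀ := g a) rfl
    (fun x => Complex.exp_ne_zero _)
  have h1 : Complex.exp (g a - h a) = 1 := by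
    rw [Complex.exp_sub, e a, div_self (Complex.exp_ne_zero _)]
  have := key.unique (y₁ := ⟨g, hg⟩) (y₂ := ⟨fun x => h x + (g a - h a), by fun_prop⟩)
    ⟨rfl, rfl⟩ ⟨by simp, by funext x; simp [Complex.exp_add, h1, e x]⟩
  have := congrArg (fun φ : C(ℝ, ℂ) => φ b) this
  simp only [ContinuousMap.coe_mk] at this
  rw [this]; ring

/-- For disjoint curves `α` and `β`, the total variation of the argument of `β t - α s` along the
boundary of the unit square vanishes. -/
theorem log_increment_square {α β : ℝ → ℂ} (hα : Continuous α) (hβ : Continuous β)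
    (hne : ∀ s t, α s ≠ β t) {ga gb gc gd : ℝ → ℂ} (ha : Continuous ga) (hb : Continuous gb)
    (hc : Continuous gc) (hd : Continuous gd)
    (ea : ∀ t, Complex.exp (ga t) = β t - α 0) (eb : ∀ t, Complex.exp (gb t) = β t - α 1)
    (ec : ∀ t, Complex.exp (gc t) = α t - β 0) (ed : ∀ t, Complex.exp (gd t) = α t - β 1) :
    (ga 1 - ga 0) + (gd 1 - gd 0) - (gb 1 - gb 0) - (gc 1 - gc 0) = 0 := by
  -- A single logarithm of `β t - α s` makes the four sides telescope. On the `c` and `d` sides the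
  -- difference has the opposite sign, hence the shift by `π * I`.
  obtain ⟨L, hL, eL⟩ := exists_continuous_log (f := fun x => β x.2 - α x.1) (by fun_prop)
    (fun x => sub_ne_zero.mpr (hne _ _).symm)
  have h1 := log_increment_unique ha (h := fun t => L (0, t)) (by fun_prop)
    (fun t => by rw [ea, eL]) 0 1
  have h2 := log_increment_unique hb (h := fun t => L (1, t)) (by fun_prop)
    (fun t => by rw [eb, eL]) 0 1
  have h3 := log_increment_unique hc (h := fun t => L (t, 0) + Real.pi * Complex.I) (by fun_prop)
    (fun t => by rw [ec, Complex.exp_add, eL, Complex.exp_pi_mul_I]; ring) 0 1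
  have h4 := log_increment_unique hd (h := fun t => L (t, 1) + Real.pi * Complex.I) (by fun_prop)
    (fun t => by rw [ed, Complex.exp_add, eL, Complex.exp_pi_mul_I]; ring) 0 1
  rw [h1, h2, h3, h4]; ring

/-! ### Nonplanarity of K5. -/

/-- There is no drawing of the complete graph on five vertices in the complex plane in which
disjoint edges do not meet. -/
theorem not_planar_five_complex (p : Fin 5 → ℂ) (U : Fin 5 → Fin 5 → Set ℂ)
    (hU : ∀ i j, i < j → JoinedIn (U i j) (p i) (p j))
    (hd : ∀ i j k l, i < j → k < l → i ≠ k → i ≠ l → j ≠ k → j ≠ l →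
      Disjoint (U i j) (U k l)) : False := by
  have h1 : ∀ i j, i < j → ∃ γ : ℝ → ℂ, Continuous γ ∧ γ 0 = p i ∧ γ 1 = p j ∧
      ∀ t, γ t ∈ U i j := fun i j h =>
    ⟨(hU i j h).somePath.extend, Path.continuous_extend _, by simp, by simp,
      fun t => (hU i j h).somePath_mem _⟩
  choose! γ γc γ0 γ1 γU using h1
  have hne : ∀ i j k l, i < j → k < l → i ≠ k → i ≠ l → j ≠ k → j ≠ l → ∀ s t,
      γ i j s ≠ γ k l t := fun i j k l h h' a b c d s t e =>
    Set.disjoint_left.mp (hd i j k l h h' a b c d) (γU i j h s) (e ▸ γU k l h' t)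
  have hpt : ∀ u i j, i < j → u ≠ i → u ≠ j → ∀ t, γ i j t - p u ≠ 0 := by
    intro u i j hij hui huj t
    -- The edge from `u` to a further vertex `w` is disjoint from `i j`, so `p u` is not on the
    -- latter.
    obtain ⟨w, hwu, hwi, hwj⟩ : ∃ w : Fin 5, w ≠ u ∧ w ≠ i ∧ w ≠ j := by
      clear * -
      decide +revert
    rw [sub_ne_zero]
    rcases lt_or_gt_of_ne hwu with h | h
    · rw [← γ1 w u h]; exact hne _ _ _ _ hij h hwi.symm hui.symm hwj.symm huj.symm _ _
    · rw [← γ0 u w h]; exact hne _ _ _ _ hij h hui.symm hwi.symm huj.symm hwj.symm _ _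
  have hp : ∀ u v, u ≠ v → p v - p u ≠ 0 := by
    intro u v huv
    obtain ⟨w, hwu, hwv⟩ : ∃ w : Fin 5, w ≠ u ∧ w ≠ v := by
      clear * -
      decide +revert
    rcases lt_or_gt_of_ne hwv with h | h
    · rw [← γ1 w v h]; exact hpt u w v h hwu.symm huv _
    · rw [← γ0 v w h]; exact hpt u v w h huv hwu.symm _
  let σ : Fin 5 → Fin 5 → ℤ := fun v u => if v < u then 1 else 0
  -- Normalized so that `α v u` and `α u v` differ by exactly `π * I` up to sign: the logarithms
  -- cancel in `cell`, leaving only `σ` and the turning numbers `k`.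
  let α : Fin 5 → Fin 5 → ℂ := fun v u =>
    Complex.log (p (max v u) - p (min v u)) + σ v u * (Real.pi * Complex.I)
  have hα : ∀ u v, u ≠ v → Complex.exp (α v u) = p v - p u := by
    intro u v huv
    rcases lt_or_gt_of_ne huv with h | h
    · simp [α, σ, h.le, not_lt.mpr h.le, Complex.exp_log (hp u v huv)]
    · simp [α, σ, h.le, h, Complex.exp_add, Complex.exp_log (hp v u huv.symm)]
  have h2 : ∀ u i j, i < j → u ≠ i → u ≠ j → ∃ g : ℝ → ℂ, Continuous g ∧
      (∀ t, Complex.exp (g t) = γ i j t - p u) ∧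
      ∃ k : ℤ, g 1 - g 0 = α j u - α i u + k * (2 * Real.pi * Complex.I) := by
    intro u i j h hui huj
    have := γc i j h
    obtain ⟨g, gc, hg⟩ := exists_continuous_log_real (f := fun t => γ i j t - p u)
      (by fun_prop) (hpt u i j h hui huj)
    refine ⟨g, gc, hg, ?_⟩
    have e1 := hg 1
    have e0 := hg 0
    rw [γ1 i j h, ← hα u j huj, Complex.exp_eq_exp_iff_exists_int] at e1
    rw [γ0 i j h, ← hα u i hui, Complex.exp_eq_exp_iff_exists_int] at e0
    obtain ⟨m, hm⟩ := e1
    obtain ⟨n, hn⟩ := e0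
    exact ⟨m - n, by rw [hm, hn]; push_cast; ring⟩
  choose! g gc hg k hk using h2
  have cell : ∀ a b c d, a < b → c < d → a ≠ c → a ≠ d → b ≠ c → b ≠ d →
      σ d a - σ c a + σ b d - σ a d - σ d b + σ c b - σ b c + σ a c +
        2 * (k a c d + k d a b - k b c d - k c a b) = 0 := by
    intro a b c d hab hcd hac had hbc hbd
    have key := log_increment_square (γc a b hab) (γc c d hcd)
      (hne a b c d hab hcd hac had hbc hbd)
      (gc a c d hcd hac had) (gc b c d hcd hbc hbd) (gc c a b hab hac.symm hbc.symm)
      (gc d a b hab had.symm hbd.symm)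
      (by rw [γ0 a b hab]; exact hg a c d hcd hac had)
      (by rw [γ1 a b hab]; exact hg b c d hcd hbc hbd)
      (by rw [γ0 c d hcd]; exact hg c a b hab hac.symm hbc.symm)
      (by rw [γ1 c d hcd]; exact hg d a b hab had.symm hbd.symm)
    rw [hk a c d hcd hac had, hk b c d hcd hbc hbd, hk c a b hab hac.symm hbc.symm,
      hk d a b hab had.symm hbd.symm] at key
    simp only [α, max_comm d a, min_comm d a, max_comm c a, min_comm c a, max_comm b d,
      min_comm b d, max_comm c b, min_comm c b] at key
    have hpi : (Real.pi * Complex.I : ℂ) ≠ 0 := by simp [Real.pi_ne_zero]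
    have : (((σ d a - σ c a + σ b d - σ a d - σ d b + σ c b - σ b c + σ a c +
        2 * (k a c d + k d a b - k b c d - k c a b) : ℤ) : ℂ)) * (Real.pi * Complex.I) = 0 := by
      rw [← key]; push_cast; ring
    exact_mod_cast (mul_eq_zero.mp this).resolve_right hpi
  have c0 := cell 0 1 2 3 (by decide) (by decide) (by decide) (by decide) (by decide) (by decide)
  have c1 := cell 0 1 2 4 (by decide) (by decide) (by decide) (by decide) (by decide) (by decide)
  have c2 := cell 0 1 3 4 (by decide) (by decide) (by decide) (by decide) (by decide) (by decide)
  have c3 := cell 0 2 1 3 (by decide) (by decide) (by decide) (by decide) (by decide) (by decide)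
  have c4 := cell 0 2 1 4 (by decide) (by decide) (by decide) (by decide) (by decide) (by decide)
  have c5 := cell 0 2 3 4 (by decide) (by decide) (by decide) (by decide) (by decide) (by decide)
  have c6 := cell 0 3 1 2 (by decide) (by decide) (by decide) (by decide) (by decide) (by decide)
  have c7 := cell 0 3 1 4 (by decide) (by decide) (by decide) (by decide) (by decide) (by decide)
  have c8 := cell 0 3 2 4 (by decide) (by decide) (by decide) (by decide) (by decide) (by decide)
  have c9 := cell 0 4 1 2 (by decide) (by decide) (by decide) (by decide) (by decide) (by decide)
  have c10 := cell 0 4 1 3 (by decide) (by decide) (by decide) (by decide) (by decide) (by decide)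
  have c11 := cell 0 4 2 3 (by decide) (by decide) (by decide) (by decide) (by decide) (by decide)
  have c12 := cell 1 2 3 4 (by decide) (by decide) (by decide) (by decide) (by decide) (by decide)
  have c13 := cell 1 3 2 4 (by decide) (by decide) (by decide) (by decide) (by decide) (by decide)
  have c14 := cell 1 4 2 3 (by decide) (by decide) (by decide) (by decide) (by decide) (by decide)
  -- After halving, the `σ` part is 1 for the five interleaved pairs (such as 02, 13) and 0 for the
  -- others. Each `k u i j` occurs in two equations, one per vertex outside `u, i, j`, so the sum
  -- reads 5 ≡ 0 modulo 2.
  simp [σ] at c0 c1 c2 c3 c4 c5 c6 c7 c8 c9 c10 c11 c12 c13 c14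
  omega

/-- There is no drawing of the complete graph on five vertices in the plane in which disjoint edges
do not meet. -/
theorem not_planar_five (p : Fin 5 → Plane) (U : Fin 5 → Fin 5 → Set Plane)
    (hU : ∀ i j, i < j → JoinedIn (U i j) (p i) (p j))
    (hd : ∀ i j k l, i < j → k < l → i ≠ k → i ≠ l → j ≠ k → j ≠ l →
      Disjoint (U i j) (U k l)) : False := by
  let φ : Plane → ℂ := fun x => ⟨x 0, x 1⟩
  have hφ : Continuous φ := by
    have : φ = fun x => (x 0 : ℂ) + (x 1 : ℂ) * Complex.I := by
      funext x
      exact Complex.mk_eq_add_mul_I _ _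
    rw [this]
    fun_prop
  have inj : Function.Injective φ := by
    intro x y h
    have h := Complex.ext_iff.mp h
    ext i
    fin_cases i
    exacts [h.1, h.2]
  exact not_planar_five_complex (φ ∘ p) (fun i j => φ '' U i j)
    (fun i j h => (hU i j h).map hφ)
    (fun i j k l h h' a b c d => (Set.disjoint_image_iff inj).mpr (hd i j k l h h' a b c d))

/-- There is no drawing of the complete graph on four vertices together with an apex `s` in which
disjoint edges do not meet. -/
theorem not_planar_apex_four (s : Plane) (x : Fin 4 → Plane) (A : Fin 4 → Set Plane)
    (B : Fin 4 → Fin 4 → Set Plane) (hA : ∀ i, JoinedIn (A i) s (x i))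
    (hB : ∀ i j, i < j → JoinedIn (B i j) (x i) (x j))
    (hAB : ∀ i j k, j < k → i ≠ j → i ≠ k → Disjoint (A i) (B j k))
    (h1 : Disjoint (B 0 1) (B 2 3)) (h2 : Disjoint (B 0 2) (B 1 3))
    (h3 : Disjoint (B 0 3) (B 1 2)) : False := by
  have hBB : ∀ i j k l, i < j → k < l → i ≠ k → i ≠ l → j ≠ k → j ≠ l →
      Disjoint (B i j) (B k l) := by
    intro i j k l hij hkl a b c d
    fin_cases i <;> fin_cases j <;> first | exact absurd hij (by decide) | skip
    all_goals fin_cases k <;> fin_cases l <;> first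
      | exact absurd hkl (by decide) | exact absurd rfl a | exact absurd rfl b
      | exact absurd rfl c | exact absurd rfl d
      | exact h1 | exact h2 | exact h3 | exact h1.symm | exact h2.symm | exact h3.symm
  -- Index 0 is the apex; `∅` fills entries with second index 0, which `i < j` excludes.
  refine not_planar_five (Fin.cons s x) (fun i j => Fin.cases (motive := fun _ => Set Plane)
    (Fin.cases (motive := fun _ => Set Plane) ∅ A j)
    (fun i' => Fin.cases (motive := fun _ => Set Plane) ∅ (B i') j) i) ?_ ?_
  · intro i j h
    cases j using Fin.cases with
    | zero => simp at h
    | succ j =>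
      cases i using Fin.cases with
      | zero => exact hA j
      | succ i => exact hB i j (Fin.succ_lt_succ_iff.mp h)
  · intro i j k l hij hkl a b c d
    cases j using Fin.cases with
    | zero => simp at hij
    | succ j =>
      cases l using Fin.cases with
      | zero => simp at hkl
      | succ l =>
        cases i using Fin.cases with
        | zero =>
          cases k using Fin.cases with
          | zero => exact absurd rfl a
          | succ k =>
            exact hAB j k l (Fin.succ_lt_succ_iff.mp hkl) (by simpa using c) (by simpa using d)
        | succ i =>
          cases k using Fin.cases with
          | zero =>
            exact (hAB l i j (Fin.succ_lt_succ_iff.mp hij) (by simpa using b.symm)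
              (by simpa using d.symm)).symm
          | succ k =>
            exact hBB i j k l (Fin.succ_lt_succ_iff.mp hij) (Fin.succ_lt_succ_iff.mp hkl)
              (by simpa using a) (by simpa using b) (by simpa using c) (by simpa using d)

/-! ### Subdrawings and faces. -/

namespace PlaneDrawing

variable {V : Type u} {G : SimpleGraph V}

/-- The part of a drawing that represents the subgraph induced on a set of vertices. -/
def trace (D : PlaneDrawing G) (S : Set V) : Set Plane :=
  D.vertex '' S ∪ ⋃ e : {e : G.edgeSet // ∀ v ∈ (e : Sym2 V), v ∈ S}, D.edge e

theorem vertex_mem_trace {D : PlaneDrawing G} {S : Set V} {v : V} :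
    D.vertex v ∈ D.trace S ↔ v ∈ S := by
  refine ⟨?_, fun h => Or.inl ⟨v, h, rfl⟩⟩
  rintro (⟨w, hw, h⟩ | h)
  · exact D.vertex_injective h ▸ hw
  · obtain ⟨e, he⟩ := Set.mem_iUnion.mp h
    exact e.2 v (D.mem_of_vertex_mem _ _ he)

theorem trace_mono (D : PlaneDrawing G) {S T : Set V} (h : S ⊆ T) : D.trace S ⊆ D.trace T := by
  rintro x (⟨v, hv, rfl⟩ | hx)
  · exact Or.inl ⟨v, h hv, rfl⟩
  · obtain ⟨e, he⟩ := Set.mem_iUnion.mp hx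
    exact Or.inr (Set.mem_iUnion.mpr ⟨⟨e.1, fun v hv => h (e.2 v hv)⟩, he⟩)

/-- A common point of two edges is a vertex, and a vertex lies in a trace only if it belongs to the
set. -/
theorem trace_disjoint (D : PlaneDrawing G) {S T : Set V} (h : Disjoint S T) :
    Disjoint (D.trace S) (D.trace T) := by
  have hv : ∀ v, D.vertex v ∈ D.trace S → D.vertex v ∉ D.trace T := fun v h1 h2 =>
    Set.disjoint_left.mp h (vertex_mem_trace.mp h1) (vertex_mem_trace.mp h2)
  rw [Set.disjoint_left]
  intro x hx hx'
  obtain ⟨v, rfl⟩ : x ∈ Set.range D.vertex := by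
    rcases hx with ⟨v, -, rfl⟩ | hx
    · exact ⟨v, rfl⟩
    rcases hx' with ⟨v, -, rfl⟩ | hx'
    · exact ⟨v, rfl⟩
    obtain ⟨e, he⟩ := Set.mem_iUnion.mp hx
    obtain ⟨f, hf⟩ := Set.mem_iUnion.mp hx'
    refine D.edge_inter_edge e f (fun hef => ?_) ⟨he, hf⟩
    obtain ⟨⟨⟨a, b⟩, hab⟩, h1⟩ := e
    refine Set.disjoint_left.mp h (h1 a (Sym2.mem_mk_left a b)) (f.2 a ?_)
    rw [← hef]
    exact Sym2.mem_mk_left a b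
  exact hv v hx hx'

theorem joinedIn_trace_of_adj (D : PlaneDrawing G) {S : Set V} {u v : V} (h : G.Adj u v)
    (hu : u ∈ S) (hv : v ∈ S) : JoinedIn (D.trace S) (D.vertex u) (D.vertex v) := by
  obtain ⟨γ, -, hγ⟩ := D.isArc u v h
  refine ⟨γ, fun t => Or.inr (Set.mem_iUnion.mpr ⟨⟨⟨s(u, v), h⟩, ?_⟩, ?_⟩)⟩
  · intro w hw
    rcases Sym2.mem_iff.mp hw with rfl | rfl <;> assumption
  · rw [← hγ]
    exact ⟨t, rfl⟩

theorem isCompact_edge (D : PlaneDrawing G) (e : G.edgeSet) : IsCompact (D.edge e) := by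
  obtain ⟨⟨u, v⟩, h⟩ := e
  obtain ⟨γ, -, hγ⟩ := D.isArc u v h
  have : IsCompact (Set.range γ) := isCompact_range γ.continuous
  rwa [hγ] at this

theorem carrier_eq_trace (D : PlaneDrawing G) : D.carrier = D.trace Set.univ := by
  apply Set.Subset.antisymm
  · rintro x (⟨v, rfl⟩ | hx)
    · exact vertex_mem_trace.mpr trivial
    · obtain ⟨e, he⟩ := Set.mem_iUnion.mp hx
      exact Or.inr (Set.mem_iUnion.mpr ⟨⟨e, fun _ _ => trivial⟩, he⟩)
  · rintro x (⟨v, -, rfl⟩ | hx)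
    · exact Or.inl ⟨v, rfl⟩
    · obtain ⟨e, he⟩ := Set.mem_iUnion.mp hx
      exact Or.inr (Set.mem_iUnion.mpr ⟨e, he⟩)

theorem IsFace.disjoint_trace {D : PlaneDrawing G} {F : Set Plane} (h : D.IsFace F) (S : Set V) :
    Disjoint F (D.trace S) := by
  obtain ⟨x, hx, rfl⟩ := h
  refine Set.disjoint_left.mpr fun y hy hy' => ?_
  exact connectedComponentIn_subset _ _ hy
    (D.carrier_eq_trace ▸ D.trace_mono (Set.subset_univ S) hy')

variable [Finite V]

theorem isCompact_trace (D : PlaneDrawing G) (S : Set V) : IsCompact (D.trace S) := by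
  have : Finite (Sym2 V) := inferInstance
  exact ((S.toFinite.image _).isCompact).union (isCompact_iUnion fun e => D.isCompact_edge e)

theorem IsFace.isPathConnected {D : PlaneDrawing G} {F : Set Plane} (h : D.IsFace F) :
    IsPathConnected F := by
  obtain ⟨x, hx, rfl⟩ := h
  have ho : IsOpen D.carrierᶜ := by
    rw [D.carrier_eq_trace]
    exact (D.isCompact_trace _).isClosed.isOpen_compl
  exact ho.connectedComponentIn.isConnected_iff_isPathConnected.mp
    (isConnected_connectedComponentIn_iff.mpr hx)

/-- A vertex on the boundary of a face can be joined to any point of the face without meeting the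
part of the drawing that avoids the vertex. -/
theorem IsFace.exists_joinedIn {D : PlaneDrawing G} {F : Set Plane} (h : D.IsFace F)
    {s : Plane} (hs : s ∈ F) {v : V} (hv : D.vertex v ∈ frontier F) :
    ∃ A : Set Plane, JoinedIn A s (D.vertex v) ∧ Disjoint A (D.trace {v}ᶜ) := by
  have ho : IsOpen (D.trace {v}ᶜ)ᶜ := (D.isCompact_trace _).isClosed.isOpen_compl
  obtain ⟨ε, hε, hb⟩ := Metric.isOpen_iff.mp ho (D.vertex v)
    (fun hm => vertex_mem_trace.mp hm rfl)
  obtain ⟨y, hyF, hy⟩ := Metric.mem_closure_iff.mp (frontier_subset_closure hv) ε hε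
  have hy : y ∈ Metric.ball (D.vertex v) ε := by rwa [Metric.mem_ball']
  -- A small ball around the vertex misses the closed rest of the drawing and meets the face.
  refine ⟨F ∪ Metric.ball (D.vertex v) ε, ?_, ?_⟩
  · have h1 := (h.isPathConnected.joinedIn s hs y hyF).mono
      (Set.subset_union_left (t := Metric.ball (D.vertex v) ε))
    have h2 := ((Metric.isPathConnected_ball hε).joinedIn y hy _
      (Metric.mem_ball_self hε)).mono (Set.subset_union_right (s := F))
    exact h1.trans h2
  · exact (h.disjoint_trace _).union_left (Set.disjoint_left.mpr fun x hx => hb hx)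

/-- A drawing with all vertices on the boundary of one face contains no subdivision of the
complete graph on four vertices. The set `S i j` carries the path between the branch vertices
`x i` and `x j`. -/
theorem IsFace.no_subdivision_four {D : PlaneDrawing G} {F : Set Plane} (h : D.IsFace F)
    (hF : ∀ v, D.vertex v ∈ frontier F) (x : Fin 4 → V) (S : Fin 4 → Fin 4 → Set V)
    (hS : ∀ i j, i < j → JoinedIn (D.trace (S i j)) (D.vertex (x i)) (D.vertex (x j)))
    (h1 : Disjoint (S 0 1) (S 2 3)) (h2 : Disjoint (S 0 2) (S 1 3))
    (h3 : Disjoint (S 0 3) (S 1 2)) : False := by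
  obtain ⟨s, hs⟩ := h.isPathConnected.nonempty
  have hm : ∀ i j, i < j → x i ∈ S i j ∧ x j ∈ S i j := fun i j hij =>
    ⟨vertex_mem_trace.mp (hS i j hij).source_mem, vertex_mem_trace.mp (hS i j hij).target_mem⟩
  -- The path from `x i` to the fourth branch vertex is disjoint from the opposite path `S j k`.
  have hx : ∀ i j k, j < k → i ≠ j → i ≠ k → x i ∉ S j k := by
    rw [Set.disjoint_left] at h1 h2 h3
    have m01 := hm 0 1 (by decide)
    have m02 := hm 0 2 (by decide)
    have m03 := hm 0 3 (by decide)
    have m12 := hm 1 2 (by decide)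
    have m13 := hm 1 3 (by decide)
    have m23 := hm 2 3 (by decide)
    intro i j k hjk hij hik hi
    fin_cases j <;> fin_cases k <;> simp at hjk <;> fin_cases i <;> simp at hij hik hi
    exacts [h1 hi m23.1, h1 hi m23.2, h2 hi m13.1, h2 hi m13.2, h3 hi m12.1, h3 hi m12.2,
      h3 m03.1 hi, h3 m03.2 hi, h2 m02.1 hi, h2 m02.2 hi, h1 m01.1 hi, h1 m01.2 hi]
  choose A hA hAd using fun i => h.exists_joinedIn hs (hF (x i))
  exact not_planar_apex_four s (D.vertex ∘ x) A (fun i j => D.trace (S i j)) hA hS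
    (fun i j k hjk hij hik => (hAd i).mono_right
      (D.trace_mono fun v hv => by rintro rfl; exact hx i j k hjk hij hik hv))
    (D.trace_disjoint h1) (D.trace_disjoint h2) (D.trace_disjoint h3)

end PlaneDrawing

/-! ### Longest paths and vertices of small degree. -/

namespace SimpleGraph

variable {V : Type u} (G : SimpleGraph V)

/-- The values of `v` at `0, …, n` are the consecutive vertices of a path of `G` in `S`. -/
structure IsPathSeq (S : Set V) (n : ℕ) (v : ℕ → V) : Prop where
  injOn : Set.InjOn v (Set.Iic n)
  adj : ∀ i < n, G.Adj (v i) (v (i + 1))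
  mem : ∀ i ≤ n, v i ∈ S

variable {G} {S : Set V} {n : ℕ} {v : ℕ → V}

theorem IsPathSeq.cons (h : G.IsPathSeq S n v) {x : V} (hx : x ∈ S) (hadj : G.Adj (v 0) x)
    (hne : ∀ i ≤ n, x ≠ v i) : G.IsPathSeq S (n + 1) (fun i => if i = 0 then x else v (i - 1)) where
  injOn := by
    intro i hi j hj hij
    simp only [Set.mem_Iic] at hi hj
    by_cases h0 : i = 0 <;> by_cases h1 : j = 0 <;> simp only [h0, h1, if_true, if_false] at hij
    · omega
    · exact absurd hij (hne _ (by omega))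
    · exact absurd hij.symm (hne _ (by omega))
    · have := h.injOn (by simp only [Set.mem_Iic]; omega) (by simp only [Set.mem_Iic]; omega) hij
      omega
  adj i hi := by
    rcases i with _ | i
    · simpa using hadj.symm
    · simpa using h.adj i (by omega)
  mem i hi := by
    split_ifs
    · exact hx
    · exact h.mem _ (by omega)

/-- Reversing the initial segment of a path that is closed up by a chord. -/
theorem IsPathSeq.rotate (h : G.IsPathSeq S n v) {i : ℕ} (hin : i ≤ n)
    (hadj : G.Adj (v 0) (v i)) :
    G.IsPathSeq S n (fun t => if t < i then v (i - 1 - t) else v t) where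
  injOn := by
    intro a ha b hb hab
    simp only [Set.mem_Iic] at ha hb
    dsimp only at hab
    split_ifs at hab <;>
    · have := h.injOn (by simp only [Set.mem_Iic]; omega) (by simp only [Set.mem_Iic]; omega) hab
      omega
  adj t ht := by
    rcases lt_trichotomy (t + 1) i with h1 | h1 | h1
    · rw [if_pos (by omega), if_pos h1]
      have := h.adj (i - 1 - (t + 1)) (by omega)
      rw [show i - 1 - (t + 1) + 1 = i - 1 - t by omega] at this
      exact this.symm
    · rw [if_pos (by omega), if_neg (by omega), h1, show i - 1 - t = 0 by omega]
      exact hadj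
    · rw [if_neg (by omega), if_neg (by omega)]
      exact h.adj t ht
  mem t ht := by
    split_ifs <;> exact h.mem _ (by omega)

theorem IsPathSeq.lt_card [Finite V] (h : G.IsPathSeq S n v) : n < Nat.card V := by
  have h1 : (v '' Set.Iic n).ncard = n + 1 := by
    rw [h.injOn.ncard_image, ← Nat.card_coe_set_eq]
    simp
  have h2 := Set.ncard_le_card (v '' Set.Iic n)
  omega

theorem exists_longest_isPathSeq [Finite V] (G : SimpleGraph V) (hS : S.Nonempty) :
    ∃ n, (∃ v, G.IsPathSeq S n v) ∧ ∀ v, ¬ G.IsPathSeq S (n + 1) v := by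
  obtain ⟨x, hx⟩ := hS
  by_contra! hc
  have : ∀ n, ∃ v, G.IsPathSeq S n v := by
    intro n
    induction n with
    | zero =>
      exact ⟨fun _ => x, fun i hi j hj _ => by simp_all, fun i hi => by omega, fun _ _ => hx⟩
    | succ n ih => exact hc n ih
  obtain ⟨v, hv⟩ := this (Nat.card V)
  exact lt_irrefl _ hv.lt_card

/-- A neighbour of `v 0` off the path would prolong it, so all neighbours in `S` are on the path;
choose one other than `v 1` and `v i`. -/
theorem IsPathSeq.exists_chord (h : G.IsPathSeq S n v) (hmax : ∀ v, ¬ G.IsPathSeq S (n + 1) v)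
    (hdeg : ∀ u ∈ S, ∀ a b, ∃ w ∈ S, G.Adj u w ∧ w ≠ a ∧ w ≠ b) (i : ℕ) :
    ∃ j, 2 ≤ j ∧ j ≤ n ∧ j ≠ i ∧ G.Adj (v 0) (v j) := by
  obtain ⟨x, hx, hadj, h1, hi⟩ := hdeg (v 0) (h.mem 0 (Nat.zero_le n)) (v 1) (v i)
  obtain ⟨j, hj, rfl⟩ : ∃ j ≤ n, x = v j := by
    by_contra! hc
    exact hmax _ (h.cons hx hadj hc)
  refine ⟨j, ?_, hj, fun e => hi (e ▸ rfl), hadj⟩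
  have h0 : j ≠ 0 := by rintro rfl; exact hadj.ne rfl
  have h1 : j ≠ 1 := by rintro rfl; exact h1 rfl
  omega

/-- If every vertex of `S` has three neighbours in `S`, then some path in `S` has chords from
`v 0` to `v i` and `v j`, and from `v (i - 1)` to `v m`, where `i < j` and `i < m`. -/
theorem exists_crossing_chords [Finite V] (hS : S.Nonempty)
    (hdeg : ∀ u ∈ S, ∀ a b, ∃ w ∈ S, G.Adj u w ∧ w ≠ a ∧ w ≠ b) :
    ∃ n v i j m, G.IsPathSeq S n v ∧ 2 ≤ i ∧ i < j ∧ i < m ∧ j ≤ n ∧ m ≤ n ∧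
      G.Adj (v 0) (v i) ∧ G.Adj (v 0) (v j) ∧ G.Adj (v (i - 1)) (v m) := by
  classical
  obtain ⟨n, ⟨v₀, hv₀⟩, hmax⟩ := exists_longest_isPathSeq G hS
  have hex : ∃ i, ∃ v, G.IsPathSeq S n v ∧ 2 ≤ i ∧ i ≤ n ∧ G.Adj (v 0) (v i) := by
    obtain ⟨j, h2, hj, -, hadj⟩ := hv₀.exists_chord hmax hdeg 1
    exact ⟨j, v₀, hv₀, h2, hj, hadj⟩
  -- The chord index `i` is least over all longest paths, so the bound also applies to the rotated
  -- path, which starts at `v (i - 1)` and agrees with `v` from index `i` on.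
  have hmin : ∀ j v, G.IsPathSeq S n v → 2 ≤ j → j ≤ n → G.Adj (v 0) (v j) →
      Nat.find hex ≤ j := fun j v h h2 hj ha => Nat.find_min' hex ⟨v, h, h2, hj, ha⟩
  obtain ⟨v, hv, h2, hi, hadj⟩ := Nat.find_spec hex
  generalize Nat.find hex = i at *
  obtain ⟨j, hj2, hjn, hji, hj⟩ := hv.exists_chord hmax hdeg i
  have hw := hv.rotate hi hadj
  obtain ⟨m, hm2, hmn, hmi, hm⟩ := hw.exists_chord hmax hdeg i
  have hij := hmin j v hv hj2 hjn hj
  have him := hmin m _ hw hm2 hmn hm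
  rw [if_pos (by omega), if_neg (by omega), Nat.sub_zero] at hm
  exact ⟨n, v, i, j, m, hv, h2, by omega, by omega, hjn, hmn, hadj, hj, hm⟩

theorem IsPathSeq.disjoint_image (h : G.IsPathSeq S n v) {A B : Set ℕ} (hA : A ⊆ Set.Iic n)
    (hB : B ⊆ Set.Iic n) (hd : ∀ x ∈ A, x ∉ B) : Disjoint (v '' A) (v '' B) := by
  rw [Set.disjoint_left]
  rintro _ ⟨a, ha, rfl⟩ ⟨b, hb, hab⟩
  exact hd a ha (h.injOn (hB hb) (hA ha) hab ▸ hb)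

theorem IsPathSeq.joinedIn_trace (h : G.IsPathSeq S n v) (D : PlaneDrawing G) {a b : ℕ}
    (hab : a ≤ b) (hb : b ≤ n) {T : Set V} (hT : v '' Set.Icc a b ⊆ T) :
    JoinedIn (D.trace T) (D.vertex (v a)) (D.vertex (v b)) := by
  induction b, hab using Nat.le_induction with
  | base => exact JoinedIn.refl (PlaneDrawing.vertex_mem_trace.mpr (hT ⟨a, by simp, rfl⟩))
  | succ b hab ih =>
    refine (ih (by omega) ((Set.image_mono (Set.Icc_subset_Icc_right (by omega))).trans hT)).trans
      (D.joinedIn_trace_of_adj (h.adj b (by omega)) (hT (Set.mem_image_of_mem v ?_))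
        (hT (Set.mem_image_of_mem v ?_))) <;>
    · simp only [Set.mem_Icc]
      omega

/-- In a subset of the vertices of an outerplanar graph, some vertex has at most two
neighbours. -/
theorem exists_neighbors_subset_pair [Finite V] (hG : IsOuterplanar G) (hS : S.Nonempty) :
    ∃ u ∈ S, ∃ a b, ∀ w ∈ S, G.Adj u w → w = a ∨ w = b := by
  by_contra! hdeg
  obtain ⟨D, F, ⟨hF, -⟩, hv⟩ := hG
  obtain ⟨n, v, i, j, m, h, h2, hij, him, hjn, hmn, a02, a03, a13⟩ :=
    exists_crossing_chords hS hdeg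
  have hpair : ∀ a b, G.Adj (v a) (v b) →
      JoinedIn (D.trace (v '' {a, b})) (D.vertex (v a)) (D.vertex (v b)) := fun a b hab =>
    D.joinedIn_trace_of_adj hab
      (Set.mem_image_of_mem v (by simp)) (Set.mem_image_of_mem v (by simp))
  have a12 : G.Adj (v (i - 1)) (v i) := by
    have := h.adj (i - 1) (by omega)
    rwa [show i - 1 + 1 = i by omega] at this
  have p13 : JoinedIn (D.trace (v '' ({i - 1} ∪ Set.uIcc m j))) (D.vertex (v (i - 1)))
      (D.vertex (v j)) := by
    refine (D.joinedIn_trace_of_adj a13 (Set.mem_image_of_mem v (by simp))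
      (Set.mem_image_of_mem v (by simp))).trans ?_
    rcases le_total m j with hmj | hmj
    · exact h.joinedIn_trace D hmj hjn
        (Set.image_mono (by rw [Set.uIcc_of_le hmj]; exact Set.subset_union_right))
    · exact (h.joinedIn_trace D hmj hmn
        (Set.image_mono (by rw [Set.uIcc_of_ge hmj]; exact Set.subset_union_right))).symm
  -- The paths 13 and 23 may overlap when `m < j`; this is harmless, since only opposite paths need
  -- be disjoint.
  refine hF.no_subdivision_four hv ![v 0, v (i - 1), v i, v j]
    (fun a b => v '' (![![∅, Set.Icc 0 (i - 1), {0, i}, {0, j}],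
      ![∅, ∅, {i - 1, i}, {i - 1} ∪ Set.uIcc m j], ![∅, ∅, ∅, Set.Icc i j],
      ![∅, ∅, ∅, ∅]] a b)) ?_ ?_ ?_ ?_
  · intro a b hab
    fin_cases a <;> fin_cases b <;> first | exact absurd hab (by decide) | skip
    exacts [h.joinedIn_trace D (by omega) (by omega) subset_rfl, hpair _ _ a02, hpair _ _ a03,
      hpair _ _ a12, p13, h.joinedIn_trace D (by omega) (by omega) subset_rfl]
  all_goals
    refine h.disjoint_image (fun x hx => ?_) (fun x hx => ?_) (fun x hx hx' => ?_) <;>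
    simp [Set.mem_uIcc] at * <;> omega

end SimpleGraph

/-! ### List colorings by removal of a vertex. -/

section Coloring

variable {V : Type u} {C : Type w} {G : SimpleGraph V} {L : V → Finset C}

/-- If every nonempty set of vertices has a member with at most two neighbours in the set, then
lists of three colors admit two different colorings of every nonempty set of vertices. -/
theorem exists_two_colorings
    (hG : ∀ S : Set V, S.Nonempty → ∃ u ∈ S, ∃ a b, ∀ w ∈ S, G.Adj u w → w = a ∨ w = b)
    (hL : ∀ v, (L v).card = 3) (S : Finset V) (hS : S.Nonempty) :
    ∃ c c' : V → C, ((∀ v, c v ∈ L v) ∧ ∀ x ∈ S, ∀ y ∈ S, G.Adj x y → c x ≠ c y) ∧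
      ((∀ v, c' v ∈ L v) ∧ ∀ x ∈ S, ∀ y ∈ S, G.Adj x y → c' x ≠ c' y) ∧ ∃ z ∈ S, c z ≠ c' z := by
  classical
  induction S using Finset.strongInduction with
  | H S ih =>
  obtain ⟨u, hu, a, b, hab⟩ := hG S hS
  have extend : ∀ c : V → C, (∀ v, c v ∈ L v) →
      (∀ x ∈ S.erase u, ∀ y ∈ S.erase u, G.Adj x y → c x ≠ c y) →
      ∀ k ∈ L u, (∀ w ∈ S, G.Adj u w → k ≠ c w) → (∀ v, Function.update c u k v ∈ L v) ∧
        ∀ x ∈ S, ∀ y ∈ S, G.Adj x y → Function.update c u k x ≠ Function.update c u k y := by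
    intro c hc hp k hk hkw
    constructor
    · intro v
      by_cases h : v = u
      · subst h; simpa using hk
      · simpa [h] using hc v
    · intro x hx y hy hxy
      by_cases h : x = u
      · subst h
        simpa [hxy.ne'] using hkw y hy hxy
      · by_cases h' : y = u
        · subst h'
          simpa [h] using (hkw x hx hxy.symm).symm
        · simpa [h, h'] using hp x (by simp [h, hx]) y (by simp [h', hy]) hxy
  rcases (S.erase u).eq_empty_or_nonempty with he | hne
  · have hone : ∀ w ∈ S, w = u := fun w hw => by
      by_contra h
      simpa [he] using Finset.mem_erase.mpr ⟨h, hw⟩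
    have hnon : ∀ v, ∃ k, k ∈ L v := fun v => Finset.card_pos.mp (by rw [hL v]; norm_num)
    choose c hc using hnon
    obtain ⟨k, hk, k', hk', hkk⟩ := Finset.one_lt_card.mp (by rw [hL u]; norm_num : 1 < (L u).card)
    have hno : ∀ k : C, ∀ w ∈ S, G.Adj u w → k ≠ c w := fun k w hw hadj =>
      absurd (hone w hw).symm hadj.ne
    exact ⟨_, _, extend c hc (by simp [he]) k hk (hno k),
      extend c hc (by simp [he]) k' hk' (hno k'), u, hu, by simpa using hkk⟩
  -- The colorings differ at some `z ≠ u`, so recoloring `u` keeps them different.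
  · obtain ⟨c, c', ⟨hc, hp⟩, ⟨hc', hp'⟩, z, hz, hzz⟩ := ih _ (Finset.erase_ssubset hu) hne
    have pick : ∀ c : V → C, ∃ k ∈ L u, ∀ w ∈ S, G.Adj u w → k ≠ c w := by
      intro c
      have hcard : 0 < (L u \ {c a, c b}).card := by
        have h1 := Finset.le_card_sdiff {c a, c b} (L u)
        have h2 := Finset.card_le_two (a := c a) (b := c b)
        rw [hL u] at h1
        omega
      obtain ⟨k, hk⟩ := Finset.card_pos.mp hcard
      simp only [Finset.mem_sdiff, Finset.mem_insert, Finset.mem_singleton, not_or] at hk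
      refine ⟨k, hk.1, fun w hw hadj => ?_⟩
      rcases hab w hw hadj with rfl | rfl
      exacts [hk.2.1, hk.2.2]
    obtain ⟨k, hk, hkw⟩ := pick c
    obtain ⟨k', hk', hkw'⟩ := pick c'
    exact ⟨_, _, extend c hc hp k hk hkw, extend c' hc' hp' k' hk' hkw', z,
      Finset.mem_of_mem_erase hz, by simpa [Finset.ne_of_mem_erase hz] using hzz⟩

end Coloring

theorem corollary3 {V : Type u} [Finite V] [Nonempty V] (G : SimpleGraph V)
    (hG : IsOuterplanar G) : PropertyM.{u, w} G 3 := by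
  rintro ⟨C, L, hL, hu⟩
  have := Fintype.ofFinite V
  obtain ⟨c, c', ⟨hc, hp⟩, ⟨hc', hp'⟩, z, -, hz⟩ := exists_two_colorings
    (fun S hS => SimpleGraph.exists_neighbors_subset_pair hG hS) hL Finset.univ Finset.univ_nonempty
  exact hz (congrFun (hu.unique ⟨hc, fun x y => hp x (Finset.mem_univ x) y (Finset.mem_univ y)⟩
    ⟨hc', fun x y => hp' x (Finset.mem_univ x) y (Finset.mem_univ y)⟩) z)
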